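/- Let $\mathbb K=\mathbb R$ or $\mathbb C$. Let $E$ be an F-space (a complete metrizable topological vector space over $\mathbb K$) that is a linear subspace of $\mathbb K^{\mathbb N}$, $\mathbb N=\{0,1,2,\dots\}$, with continuous inclusion $E\hookrightarrow\mathbb K^{\mathbb N}$, and assume that $E$ is locally bounded or locally convex. Assume that $E$ contains the canonical unit sequences $e_n$, $n\ge 0$, and that their linear span is dense in $E$. Let $T:E\to E$ be a unilateral weighted shift, i.e. a continuous linear map with $T e_0=0$ and $T e_n=w_ne_{n-1}$ for $n\ge1$, where $w_n\in\mathbb K\setminus\{0\}$. Put $\beta_0=1$ and $\beta_n=w_1\cdots w_n$ for $n\ge1$. Random variables are $\mathbb K$-valued. A random variable $X$ has full support if $P(X\in U)>0$ for every nonempty open $U\subset\mathbb K$. It is subgaussian if there is $c>0$ with $P(|X|\ge t)\le 2e^{-ct^2}$ for all $t\ge 0$. A vector $x\in E$ is frequently hypercyclic for $T$ if for every nonempty open $U\subset E$ the set $\{n\ge0: T^nx\in U\}$ has positive lower density. A Borel probability measure $\mu$ on $E$ is exact for $T$ if it is $T$-invariant and every set $A\in\bigcap_{n\ge0}T^{-n}(\mathcal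 B(E))$ satisfies $\mu(A)\in\{0,1\}$. It has full support if $\mu(U)>0$ for every nonempty open $U\subset E$. For a random variable $X$ consider the following property $(\ast)$: whenever $(X_n)_{n\ge0}$ is a sequence of independent copies of $X$, the series $\sum_{n=0}^\infty \frac{X_n}{\beta_n}e_n$ converges almost surely in $E$, its sum is almost surely a frequently hypercyclic vector for $T$, and the law of its sum is an exact measure for $T$ with full support. (i) If $\sum_{n\ge0}\frac{e_n}{\beta_n}$ converges unconditionally in $E$, then there is a random variable $X$ with full support that satisfies $(\ast)$. (ii) If $\sum_{n\ge1}\frac{\sqrt{\log n}}{\beta_n}e_n$ converges unconditionally in $E$, then every subgaussian random variable $X$ with full support satisfies $(\ast)$. In particular, $(\ast)$ holds for every non-constant Gaussian variable $X$ with values in $\mathbb K$; for $\mathbb K=\mathbb C$ this means that $(\operatorname{Re}X,\operatorname{Im}X)$ is jointly Gaussian and not concentrated on a real affine line or a point. -/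

import Mathlib

open MeasureTheory ProbabilityTheory Filter Topology

noncomputable section

/-- A topological vector space is locally bounded if `0` has a bounded neighbourhood. -/
def IsLocallyBoundedSpace (𝕂 E : Type*) [RCLike 𝕂] [AddCommGroup E] [Module 𝕂 E]
    [TopologicalSpace E] : Prop :=
  ∃ U ∈ 𝓝 (0 : E), Bornology.IsVonNBounded 𝕂 U

/-- `T` is the unilateral weighted shift with weights `(w n)` for `n ≥ 1` (the value `w 0` plays
no role): `T e₀ = 0` and `T eₙ = wₙ eₙ₋₁` for `n ≥ 1`. -/
structure IsUnilateralWeightedShift {𝕂 E : Type*} [RCLike 𝕂] [AddCommGroup E] [Module 𝕂 E]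
    [TopologicalSpace E] (e : ℕ → E) (w : ℕ → 𝕂) (T : E →L[𝕂] E) : Prop where
  weight_ne_zero : ∀ n, 1 ≤ n → w n ≠ 0
  map_unit_zero : T (e 0) = 0
  map_unit_succ : ∀ n, T (e (n + 1)) = w (n + 1) • e n

/-- `βₙ = w₁ ⋯ wₙ`, with `β₀ = 1`. -/
def shiftBeta {𝕂 : Type*} [RCLike 𝕂] (w : ℕ → 𝕂) (n : ℕ) : 𝕂 :=
  ∏ k ∈ Finset.Icc 1 n, w k

open Classical in
/-- The lower density `liminf_N #(A ∩ {0, …, N - 1}) / N` of a set of natural numbers. -/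
def natLowerDensity (A : Set ℕ) : ℝ :=
  liminf (fun N : ℕ => (((Finset.range N).filter (· ∈ A)).card : ℝ) / N) atTop

/-- `x` is a frequently hypercyclic vector for `T`. -/
def IsFrequentlyHypercyclicVector {E : Type*} [TopologicalSpace E] (T : E → E) (x : E) : Prop :=
  ∀ U : Set E, IsOpen U → U.Nonempty → 0 < natLowerDensity {n | T^[n] x ∈ U}

/-- `μ` is an exact measure for `T`: a `T`-invariant probability measure for which
the σ-algebra `⋂ₙ T⁻ⁿ(𝓑)` is trivial. -/
structure IsExactMeasure {E : Type*} [MeasurableSpace E] (T : E → E) (μ : Measure E) : Prop where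
  isProbabilityMeasure : IsProbabilityMeasure μ
  measurePreserving : MeasurePreserving T μ μ
  trivial_tail : ∀ A : Set E, (∀ n : ℕ, ∃ B : Set E, MeasurableSet B ∧ T^[n] ⁻¹' B = A) →
    μ A = 0 ∨ μ A = 1

/-- The random variable `X` charges every nonempty open subset of `𝕂`. -/
def HasFullSupport {𝕂 Ω : Type*} [RCLike 𝕂] [MeasurableSpace Ω] (X : Ω → 𝕂) (P : Measure Ω) :
    Prop :=
  ∀ U : Set 𝕂, IsOpen U → U.Nonempty → 0 < P (X ⁻¹' U)

/-- The (real or complex) random variable `X` is subgaussian: for some `c > 0`,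
`P(|X| ≥ t) ≤ 2 exp(-c t²)` for all `t ≥ 0`. -/
def IsSubgaussian {𝕂 Ω : Type*} [RCLike 𝕂] [MeasurableSpace Ω] (X : Ω → 𝕂) (P : Measure Ω) :
    Prop :=
  ∃ c : ℝ, 0 < c ∧ ∀ t : ℝ, 0 ≤ t → P.real {ω | t ≤ ‖X ω‖} ≤ 2 * Real.exp (-c * t ^ 2)

/-- `X` is a Gaussian variable with values in `𝕂`, seen as a real vector space, which is not
concentrated on a proper real affine subspace. For `𝕂 = ℝ` this is a non-constant real Gaussian
variable, and for `𝕂 = ℂ` it includes every non-constant (circularly symmetric) complex Gaussian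
variable and its translates. -/
structure IsNonconstantGaussian {𝕂 Ω : Type*} [RCLike 𝕂] [MeasurableSpace Ω] (X : Ω → 𝕂)
    (P : Measure Ω) : Prop where
  gaussian : HasGaussianLaw X P
  nonconstant : ∀ L : 𝕂 →L[ℝ] ℝ, L ≠ 0 → ¬ ∃ c : ℝ, ∀ᵐ ω ∂P, L (X ω) = c

/-- `(Y n)` is a sequence of independent copies of `X`. -/
structure IsIIDCopies {𝕂 Ω Ω' : Type*} [RCLike 𝕂] [MeasurableSpace Ω] [MeasurableSpace Ω']
    (Y : ℕ → Ω' → 𝕂) (P' : Measure Ω') (X : Ω → 𝕂) (P : Measure Ω) : Prop where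
  indep : iIndepFun Y P'
  identDistrib : ∀ n, IdentDistrib (Y n) X P' P

/-- The random series `∑ Yₙ uₙ` converges almost surely, and its sum `v` is almost surely
a frequently hypercyclic vector for `T` whose law is an exact measure for `T` with full support. -/
def IsExactFHCSeries {𝕂 E Ω : Type*} [RCLike 𝕂] [AddCommGroup E] [Module 𝕂 E]
    [TopologicalSpace E] [MeasurableSpace E] [MeasurableSpace Ω]
    (T : E →L[𝕂] E) (u : ℕ → E) (Y : ℕ → Ω → 𝕂) (P : Measure Ω) : Prop :=
  ∃ v : Ω → E, AEMeasurable v P ∧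
    (∀ᵐ ω ∂P, Tendsto (fun N => ∑ n ∈ Finset.range N, Y n ω • u n) atTop (𝓝 (v ω))) ∧
    (∀ᵐ ω ∂P, IsFrequentlyHypercyclicVector T (v ω)) ∧
    IsExactMeasure T (P.map v) ∧
    (∀ U : Set E, IsOpen U → U.Nonempty → 0 < P.map v U)

end

/-!
The shift acts on the vectors `u n = e n / β n` by `T (u 0) = 0` and `T (u (n + 1)) = u n`. Hence
`x ↦ ∑ x n • u n`, where it converges, intertwines the left shift of scalar sequences with `T`, and
the law of the random series is a factor of a Bernoulli shift.

*Convergence.* Local convexity and local boundedness both provide neighbourhoods `V` of `0` with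
`m⁻¹ • (V + V) ⊆ V` for some integer `m ≥ 2` (`HasContractingBasis`). Expanding multipliers in base
`m` then shows that unconditionally convergent series are bounded multiplier convergent
(`Summable.smul_of_norm_le_one`). So if `∑ α n • u n` converges unconditionally and
`∑ P(|X| > α n) < ∞`, the random series converges almost surely by the Borel–Cantelli lemma
(`ae_summable_smul`). For a variable with Gaussian tails one takes `α n = M √(log n)`; Fernique's
theorem provides such tails for Gaussian variables. If only `∑ u n` converges unconditionally, then
so does `∑ α n • u n` for some `α n → ∞` (`Summable.exists_tendsto_atTop_smul`), and a discrete
variable `X` with full support and a sufficiently light tail is constructed from a dense sequence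
(`exists_hasFullSupport_tsum_ne_top`).

*Exactness and support.* `T ^ n` of the sum depends only on the coordinates from `n` on, so the
sets `A` in `⋂ T⁻ⁿ(𝓑)` correspond to tail events, and Kolmogorov's zero-one law applies
(`isExactMeasure_map_series`). Full support follows from the density of the span of the `u n` and
the independence of the first coordinates from the tail of the series
(`measure_map_series_pos`). A Gaussian variable that is not concentrated on a real affine line has
full support since `Re X` and a suitable `Im X - a * Re X` are independent, nonconstant and
Gaussian.

*Frequent hypercyclicity.* This holds almost surely for every exact measure with full support
(`IsExactMeasure.ae_isFrequentlyHypercyclicVector`). Instead of Birkhoff's ergodic theorem only the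
following is needed: almost every orbit visits a set of positive measure with positive lower
density. Otherwise, by triviality of invariant sets, almost every orbit visits the set with zero
lower density, and the covering argument of Katznelson and Weiss (`visitCount_le_of_forall_exists`)
shows that the set is null.
-/

/-! ### Unconditional and bounded multiplier convergence -/

/-- Every neighbourhood of `0` contains a neighbourhood `V` of `0` such that `m⁻¹ • (V + V) ⊆ V`
for some integer `m ≥ 2`. This is what local convexity (with `m = 2`) and local boundedness have in
common, and what is needed for unconditional convergence to imply bounded multiplier convergence. -/
def HasContractingBasis (𝕂 E : Type*) [RCLike 𝕂] [AddCommGroup E] [Module 𝕂 E]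
    [TopologicalSpace E] : Prop :=
  ∀ W ∈ 𝓝 (0 : E), ∃ V ∈ 𝓝 (0 : E), V ⊆ W ∧ ∃ m : ℕ, 2 ≤ m ∧
    ∀ x ∈ V, ∀ y ∈ V, (m : 𝕂)⁻¹ • (x + y) ∈ V

section FSpace

variable {𝕂 E : Type*} [RCLike 𝕂] [AddCommGroup E] [Module 𝕂 E]

theorem LocallyConvexSpace.hasContractingBasis [TopologicalSpace E] [Module ℝ E]
    [IsScalarTower ℝ 𝕂 E] [LocallyConvexSpace ℝ E] : HasContractingBasis 𝕂 E := by
  intro W hW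
  obtain ⟨V, ⟨hV, hVc⟩, hVW⟩ := (LocallyConvexSpace.convex_basis_zero ℝ E).mem_iff.1 hW
  refine ⟨V, hV, hVW, 2, le_rfl, fun x hx y hy => ?_⟩
  have h := hVc hx hy (a := 1 / 2) (b := 1 / 2) (by norm_num) (by norm_num) (by norm_num)
  have h2 : ∀ z : E, (1 / 2 : ℝ) • z = ((2 : ℕ) : 𝕂)⁻¹ • z := by
    intro z
    rw [← one_smul 𝕂 z, ← smul_assoc, one_smul]
    congr 1
    rw [RCLike.real_smul_eq_coe_mul, mul_one]
    push_cast
    rw [one_div]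
  rwa [h2, h2, ← smul_add] at h

theorem IsLocallyBoundedSpace.hasContractingBasis [TopologicalSpace E] [IsTopologicalAddGroup E]
    [ContinuousSMul 𝕂 E] (h : IsLocallyBoundedSpace 𝕂 E) : HasContractingBasis 𝕂 E := by
  obtain ⟨U, hU, hb⟩ := h
  intro W hW
  have key : ∀ V ∈ 𝓝 (0 : E), ∃ m : ℕ, 2 ≤ m ∧ ∀ x ∈ U, (m : 𝕂)⁻¹ • x ∈ V := by
    intro V hV
    have h1 := (hb hV).eventually
    have h2 : Tendsto (fun m : ℕ => (m : 𝕂)) atTop (Bornology.cobounded 𝕂) :=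
      tendsto_norm_atTop_iff_cobounded.1 (by simpa using tendsto_natCast_atTop_atTop)
    obtain ⟨m, hm, hm2⟩ := ((h2.eventually h1).and (eventually_ge_atTop 2)).exists
    refine ⟨m, hm2, fun x hx => ?_⟩
    obtain ⟨y, hy, hyx⟩ := hm hx
    have : (m : 𝕂) ≠ 0 := by exact_mod_cast (by omega : m ≠ 0)
    rw [← hyx]
    simpa [smul_smul, inv_mul_cancel₀ this] using hy
  obtain ⟨V₀, hV₀, hadd⟩ := exists_nhds_zero_half hU
  obtain ⟨m, hm, hmU⟩ := key V₀ hV₀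
  obtain ⟨k, hk, hkU⟩ := key W hW
  have hk0 : (k : 𝕂) ≠ 0 := by exact_mod_cast (by omega : k ≠ 0)
  refine ⟨(fun x : E => (k : 𝕂) • x) ⁻¹' U, ?_, ?_, m, hm, ?_⟩
  · exact (continuous_const_smul (k : 𝕂)).continuousAt.preimage_mem_nhds (by simpa using hU)
  · intro x hx
    simpa [smul_smul, inv_mul_cancel₀ hk0] using hkU _ hx
  · intro x hx y hy
    have := hadd _ (hmU _ hx) _ (hmU _ hy)
    simp only [Set.mem_preimage]
    rwa [smul_comm, smul_add, smul_add]

/-- A finite combination with coefficients in `{0, …, m}` is a sum of `m` subsums. -/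
theorem sum_natCast_smul_eq_sum_filter {ι : Type*} (u : ι → E) (d : ι → ℕ) (m : ℕ)
    (F : Finset ι) (hd : ∀ i, d i ≤ m) :
    ∑ i ∈ F, (d i : 𝕂) • u i = ∑ j ∈ Finset.range m, ∑ i ∈ F with j < d i, u i := by
  simp_rw [Finset.sum_filter]
  rw [Finset.sum_comm]
  refine Finset.sum_congr rfl fun i _ => ?_
  rw [← Finset.sum_filter, Finset.sum_const, Nat.cast_smul_eq_nsmul]
  congr 1
  have : (Finset.range m).filter (fun j => j < d i) = Finset.range (d i) := by
    ext j
    have := hd i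
    simp only [Finset.mem_filter, Finset.mem_range]
    omega
  rw [this, Finset.card_range]

/-- Expansion of the multipliers in base `m`: the partial expansions stay in `V` because
`m⁻¹ • (V + V) ⊆ V`, and each digit contributes a combination with coefficients in
`{0, …, m}`, a sum of `m` subsums. -/
theorem exists_sum_smul_eq_add {ι : Type*} (u : ι → E) (F : Finset ι) {V : Set E}
    (h0 : (0 : E) ∈ V) {m : ℕ} (hm : 0 < m) (hV : ∀ x ∈ V, ∀ y ∈ V, (m : 𝕂)⁻¹ • (x + y) ∈ V)
    (hd : ∀ d : ι → ℕ, (∀ i, d i ≤ m) → ∑ i ∈ F, (d i : 𝕂) • u i ∈ V) (K : ℕ) :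
    ∀ a : ι → ℝ, (∀ i, a i ∈ Set.Icc (0 : ℝ) 1) → ∃ v ∈ V, ∃ b : ι → ℝ,
      (∀ i, b i ∈ Set.Icc (0 : ℝ) 1) ∧
      ∑ i ∈ F, (a i : 𝕂) • u i = v + ∑ i ∈ F, (((m : ℝ)⁻¹ ^ K * b i : ℝ) : 𝕂) • u i := by
  induction K with
  | zero => exact fun a ha => ⟨0, h0, a, ha, by simp⟩
  | succ K ih =>
    intro a ha
    have hm' : (0 : ℝ) < m := by exact_mod_cast hm
    have hmK : (m : 𝕂) ≠ 0 := by exact_mod_cast hm.ne'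
    have hfl : ∀ i, (⌊m * a i⌋₊ : ℝ) ≤ m * a i :=
      fun i => Nat.floor_le (mul_nonneg hm'.le (ha i).1)
    obtain ⟨v, hv, b, hb, hvb⟩ := ih (fun i => m * a i - ⌊m * a i⌋₊) (fun i =>
      ⟨by have := hfl i; linarith, by have := Nat.lt_floor_add_one (m * a i); linarith⟩)
    refine ⟨(m : 𝕂)⁻¹ • (∑ i ∈ F, ((⌊m * a i⌋₊ : ℕ) : 𝕂) • u i + v),
      hV _ (hd (fun i => ⌊m * a i⌋₊) fun i => ?_) _ hv, b, hb, ?_⟩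
    · exact Nat.floor_le_of_le (by nlinarith [(ha i).2])
    · have h1 : ∑ i ∈ F, (a i : 𝕂) • u i = (m : 𝕂)⁻¹ • (∑ i ∈ F, ((⌊m * a i⌋₊ : ℕ) : 𝕂) • u i
          + ∑ i ∈ F, ((m * a i - ⌊m * a i⌋₊ : ℝ) : 𝕂) • u i) := by
        rw [← Finset.sum_add_distrib, Finset.smul_sum]
        refine Finset.sum_congr rfl fun i _ => ?_
        rw [← add_smul, smul_smul]
        congr 1
        push_cast
        field_simp
        ring
      rw [h1, hvb, ← add_assoc, smul_add _ (_ + _), Finset.smul_sum]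
      congr 1
      refine Finset.sum_congr rfl fun i _ => ?_
      rw [smul_smul]
      congr 1
      push_cast
      ring

theorem sum_range_mem_of_add_subset {E : Type*} [AddCommGroup E] {V : ℕ → Set E}
    (h0 : ∀ n, (0 : E) ∈ V n)
    (hV : ∀ n, ∀ x ∈ V (n + 1), ∀ y ∈ V (n + 1), x + y ∈ V n) (l : ℕ) :
    ∀ (m : ℕ) (y : ℕ → E), (∀ k < l, y k ∈ V (m + k + 1)) → ∑ k ∈ Finset.range l, y k ∈ V m := by
  induction l with
  | zero => exact fun m y _ => by simpa using h0 m
  | succ l ih =>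
    intro m y hy
    rw [Finset.sum_range_succ']
    refine hV m _ (ih (m + 1) (fun k => y (k + 1)) fun k hk => ?_) _ ?_
    · have := hy (k + 1) (by omega)
      rwa [show m + (k + 1) + 1 = m + 1 + k + 1 by ring] at this
    · simpa using hy 0 (by omega)

variable [UniformSpace E] [IsUniformAddGroup E] [ContinuousSMul 𝕂 E]

theorem Summable.smul_of_mem_Icc [CompleteSpace E] (hE : HasContractingBasis 𝕂 E) {ι : Type*}
    {u : ι → E} (hu : Summable u) {a : ι → ℝ} (ha : ∀ i, a i ∈ Set.Icc (0 : ℝ) 1) :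
    Summable fun i => (a i : 𝕂) • u i := by
  rw [summable_iff_vanishing] at hu ⊢
  intro W hW
  obtain ⟨W', hW', hWW⟩ := exists_nhds_zero_half hW
  obtain ⟨V, hV, hVW, m, hm, hcontr⟩ := hE W' hW'
  have hsum : Tendsto (fun g : Fin m → E => ∑ j, g j) (𝓝 0) (𝓝 0) := by
    have : Continuous (fun g : Fin m → E => ∑ j, g j) := by fun_prop
    simpa using this.tendsto 0
  obtain ⟨V₁, hV₁, hV₁V⟩ : ∃ V₁ ∈ 𝓝 (0 : E), ∀ g : Fin m → E, (∀ j, g j ∈ V₁) → ∑ j, g j ∈ V := by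
    have h := hsum hV
    rw [mem_map, nhds_pi, Filter.mem_pi] at h
    obtain ⟨I, -, t, ht, hsub⟩ := h
    refine ⟨⋂ j, t j, (Filter.iInter_mem).2 ht, fun g hg => hsub fun j _ => ?_⟩
    exact Set.mem_iInter.1 (hg j) j
  obtain ⟨s, hs⟩ := hu V₁ hV₁
  refine ⟨s, fun F hF => ?_⟩
  have hd : ∀ d : ι → ℕ, (∀ i, d i ≤ m) → ∑ i ∈ F, (d i : 𝕂) • u i ∈ V := by
    intro d hd
    rw [sum_natCast_smul_eq_sum_filter u d m F hd, ← Fin.sum_univ_eq_sum_range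
      (fun j => ∑ i ∈ F with j < d i, u i)]
    exact hV₁V _ fun j => hs _ (hF.mono_left (Finset.filter_subset _ _))
  choose v hv b hb hvb using fun K => exists_sum_smul_eq_add (𝕂 := 𝕂) u F (mem_of_mem_nhds hV)
    (by omega) hcontr hd K a ha
  -- the remainder of the expansion tends to `0`, since `F` is finite
  have hrem : Tendsto (fun K => ∑ i ∈ F, (((m : ℝ)⁻¹ ^ K * b K i : ℝ) : 𝕂) • u i) atTop (𝓝 0) := by
    rw [← Finset.sum_const_zero (s := F)]
    refine tendsto_finsetSum _ fun i _ => ?_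
    rw [← zero_smul 𝕂 (u i)]
    refine Tendsto.smul_const ?_ _
    rw [← RCLike.ofReal_zero]
    refine (RCLike.continuous_ofReal.tendsto 0).comp ?_
    refine squeeze_zero (fun K => mul_nonneg (by positivity) (hb K i).1)
      (fun K => mul_le_of_le_one_right (by positivity) (hb K i).2) ?_
    refine tendsto_pow_atTop_nhds_zero_of_lt_one (by positivity) ?_
    exact inv_lt_one_of_one_lt₀ (by exact_mod_cast hm)
  obtain ⟨K, hK⟩ := (hrem.eventually hW').exists
  rw [hvb K]
  exact hWW _ (hVW (hv K)) _ hK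

/-- Bounded multiplier convergence of unconditionally convergent series. -/
theorem Summable.smul_of_norm_le_one [CompleteSpace E] (hE : HasContractingBasis 𝕂 E) {ι : Type*}
    {u : ι → E} (hu : Summable u) {a : ι → 𝕂} (ha : ∀ i, ‖a i‖ ≤ 1) :
    Summable fun i => a i • u i := by
  have key : ∀ r : ι → ℝ, (∀ i, |r i| ≤ 1) → Summable fun i => (r i : 𝕂) • u i := by
    intro r hr
    have h1 := hu.smul_of_mem_Icc hE (a := fun i => max (r i) 0)
      fun i => ⟨le_max_right _ _, max_le ((le_abs_self _).trans (hr i)) zero_le_one⟩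
    have h2 := hu.smul_of_mem_Icc hE (a := fun i => max (-r i) 0)
      fun i => ⟨le_max_right _ _, max_le ((neg_le_abs _).trans (hr i)) zero_le_one⟩
    refine (h1.sub h2).congr fun i => ?_
    rw [← sub_smul, ← RCLike.ofReal_sub]
    congr 2
    rcases le_total (r i) 0 with h | h
    · rw [max_eq_right h, max_eq_left (by linarith)]; ring
    · rw [max_eq_left h, max_eq_right (by linarith)]; ring
  have h1 := key (fun i => RCLike.re (a i)) fun i => (RCLike.abs_re_le_norm _).trans (ha i)
  have h2 := key (fun i => RCLike.im (a i)) fun i => (RCLike.abs_im_le_norm _).trans (ha i)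
  refine (h1.add (h2.const_smul (RCLike.I : 𝕂))).congr fun i => ?_
  rw [smul_smul, ← add_smul, mul_comm, RCLike.re_add_im]

theorem Summable.smul_of_eventually_norm_le [CompleteSpace E] (hE : HasContractingBasis 𝕂 E)
    {u : ℕ → E} {α : ℕ → ℝ} (hu : Summable fun n => (α n : 𝕂) • u n) {x : ℕ → 𝕂}
    (hx : ∀ᶠ n in atTop, ‖x n‖ ≤ α n) : Summable fun n => x n • u n := by
  obtain ⟨N, hN⟩ := eventually_atTop.1 hx
  rw [← summable_nat_add_iff N] at hu ⊢
  have hα : ∀ n, 0 ≤ α (n + N) := fun n => (norm_nonneg _).trans (hN _ (by omega))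
  refine (hu.smul_of_norm_le_one hE (a := fun n => x (n + N) / (α (n + N) : 𝕂)) fun n => ?_).congr
    fun n => ?_
  · rw [norm_div, RCLike.norm_ofReal, abs_of_nonneg (hα n)]
    exact div_le_one_of_le₀ (hN _ (by omega)) (hα n)
  · rw [smul_smul]
    congr 1
    refine (div_mul_cancel_of_imp fun h => ?_)
    have := hN (n + N) (by omega)
    rw [RCLike.ofReal_eq_zero.1 h] at this
    exact norm_le_zero_iff.1 this

omit [ContinuousSMul 𝕂 E] in
/-- An unconditionally convergent series in a complete metrizable space remains so after
multiplication with a suitable sequence tending to infinity: `α n` counts the thresholds `N k`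
below `n`, where the subsums beyond `N k` lie in the `k`-th neighbourhood of `0`. -/
theorem Summable.exists_tendsto_atTop_smul [CompleteSpace E]
    [(uniformity E).IsCountablyGenerated] {u : ℕ → E} (hu : Summable u) :
    ∃ α : ℕ → ℝ, Tendsto α atTop atTop ∧ Summable fun n => (α n : 𝕂) • u n := by
  have : (𝓝 (0 : E)).IsCountablyGenerated := UniformSpace.firstCountableTopology E |>.1 0
  obtain ⟨V, hVb, hVadd⟩ := IsTopologicalAddGroup.exists_antitone_basis_nhds_zero E
  replace hVadd : ∀ n, ∀ x ∈ V (n + 1), ∀ y ∈ V (n + 1), x + y ∈ V n :=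
    fun n x hx y hy => hVadd n (Set.add_mem_add hx hy)
  have hV0 : ∀ n, (0 : E) ∈ V n := fun n => mem_of_mem_nhds (hVb.1.mem_of_mem trivial)
  rw [summable_iff_vanishing] at hu
  have hN : ∀ k, ∃ N : ℕ, ∀ F : Finset ℕ, (∀ n ∈ F, N ≤ n) → ∑ n ∈ F, u n ∈ V (k + 1) := by
    intro k
    obtain ⟨s, hs⟩ := hu (V (k + 1)) (hVb.1.mem_of_mem trivial)
    refine ⟨s.sup id + 1, fun F hF => hs F (Finset.disjoint_left.2 fun n hn hns => ?_)⟩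
    have h1 := hF n hn
    have h2 : n ≤ s.sup id := Finset.le_sup (f := id) hns
    omega
  choose N hN using hN
  let c : ℕ → ℕ := fun n => ((Finset.range n).filter fun k => N k ≤ n).card
  refine ⟨fun n => c n, ?_, ?_⟩
  · refine tendsto_natCast_atTop_atTop.comp (tendsto_atTop.2 fun K => ?_)
    refine eventually_atTop.2 ⟨max K ((Finset.range K).sup N), fun n hn => ?_⟩
    calc K = (Finset.range K).card := (Finset.card_range K).symm
      _ ≤ c n := Finset.card_le_card fun k hk => by
        have h1 : N k ≤ (Finset.range K).sup N := Finset.le_sup hk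
        have h2 := Finset.mem_range.1 hk
        have h3 := le_trans (le_max_left _ _) hn
        have h4 := le_trans (le_max_right _ _) hn
        simp only [Finset.mem_filter, Finset.mem_range]
        omega
  · rw [summable_iff_vanishing]
    intro W hW
    obtain ⟨m, -, hm⟩ := hVb.1.mem_iff.1 hW
    obtain ⟨s, hs⟩ := hu (V (2 * (m + 1) + 1)) (hVb.1.mem_of_mem trivial)
    refine ⟨s, fun F hF => hm ?_⟩
    obtain ⟨M, hM, hmM⟩ : ∃ M, (∀ n ∈ F, n < M) ∧ m + 1 ≤ M :=
      ⟨F.sup id + m + 2, fun n hn => by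
        have : n ≤ F.sup id := Finset.le_sup (f := id) hn
        omega, by omega⟩
    let y : ℕ → E := fun k => ∑ n ∈ F with (k < n ∧ N k ≤ n), u n
    have hy : ∑ n ∈ F, ((c n : ℝ) : 𝕂) • u n = ∑ k ∈ Finset.range M, y k := by
      simp only [y, Finset.sum_filter]
      rw [Finset.sum_comm]
      refine Finset.sum_congr rfl fun n hn => ?_
      rw [← Finset.sum_filter, Finset.sum_const, RCLike.ofReal_natCast, Nat.cast_smul_eq_nsmul]
      refine congrArg (· • u n) (congrArg Finset.card (Finset.ext fun k => ?_))
      have := hM n hn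
      simp only [Finset.mem_filter, Finset.mem_range]
      omega
    rw [hy, ← Finset.sum_range_add_sum_Ico _ hmM, Finset.sum_Ico_eq_sum_range]
    refine hVadd m _ ?_ _ ?_
    · refine sum_range_mem_of_add_subset hV0 hVadd _ _ _ fun k hk => ?_
      exact hVb.antitone (by omega) (hs _ (hF.mono_left (Finset.filter_subset _ _)))
    · refine sum_range_mem_of_add_subset hV0 hVadd _ _ _ fun k hk => ?_
      exact hN _ _ fun n hn => (Finset.mem_filter.1 hn).2.2

end FSpace

/-! ### Lower density of visits for exact measures -/

section Visits

variable {X : Type*} {T : X → X} {A : Set X}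

/-- The number of visits of `x` to `A` before time `N`. -/
noncomputable def visitCount (T : X → X) (A : Set X) (x : X) (N : ℕ) : ℝ :=
  ∑ k ∈ Finset.range N, (T^[k] ⁻¹' A).indicator (fun _ => (1 : ℝ)) x

theorem visitCount_add (x : X) (m n : ℕ) :
    visitCount T A x (m + n) = visitCount T A x m + visitCount T A (T^[m] x) n := by
  simp only [visitCount, Finset.sum_range_add]
  congr 1
  refine Finset.sum_congr rfl fun k _ => ?_
  rw [add_comm m k, Function.iterate_add, Set.preimage_comp]
  rfl

theorem visitCount_one_mem_Icc (x : X) : visitCount T A x 1 ∈ Set.Icc (0 : ℝ) 1 := by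
  simp only [visitCount, Finset.sum_range_one, Set.indicator]
  split_ifs <;> simp

theorem visitCount_nonneg (x : X) (N : ℕ) : 0 ≤ visitCount T A x N :=
  Finset.sum_nonneg fun _ _ => Set.indicator_nonneg (fun _ _ => zero_le_one) _

theorem visitCount_le (x : X) (N : ℕ) : visitCount T A x N ≤ N := by
  calc visitCount T A x N ≤ ∑ _k ∈ Finset.range N, (1 : ℝ) :=
        Finset.sum_le_sum fun _ _ => Set.indicator_le_self' (fun _ _ => zero_le_one) _
    _ = N := by simp

theorem visitCount_mono {B : Set X} (h : A ⊆ B) (x : X) (N : ℕ) :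
    visitCount T A x N ≤ visitCount T B x N :=
  Finset.sum_le_sum fun _ _ => Set.indicator_le_indicator_of_subset (Set.preimage_mono h)
    (fun _ => zero_le_one) _

theorem natLowerDensity_eq_liminf_visitCount (x : X) :
    natLowerDensity {n | T^[n] x ∈ A} = liminf (fun N : ℕ => visitCount T A x N / N) atTop := by
  unfold natLowerDensity
  congr 1
  ext N
  congr 1
  rw [visitCount, Finset.card_filter]
  push_cast
  refine Finset.sum_congr rfl fun k _ => ?_
  rfl

theorem natLowerDensity_pos {x : X} {ε : ℝ} (hε : 0 < ε)
    (h : ∀ᶠ N : ℕ in atTop, ε * N ≤ visitCount T A x N) :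
    0 < natLowerDensity {n | T^[n] x ∈ A} := by
  rw [natLowerDensity_eq_liminf_visitCount]
  refine hε.trans_le (le_liminf_of_le ?_ ?_)
  · refine IsCoboundedUnder.of_frequently_le (a := 1) (Frequently.of_forall fun N => ?_)
    exact div_le_one_of_le₀ (visitCount_le x N) (Nat.cast_nonneg N)
  · filter_upwards [h, eventually_gt_atTop 0] with N hN h0
    rwa [le_div_iff₀ (by exact_mod_cast h0)]

/-- If every orbit can be cut into pieces of length at most `M` along which the frequency of visits
is at most `ε`, then the number of visits up to time `N` is at most `ε N + M`. -/
theorem visitCount_le_of_forall_exists {ε : ℝ} (hε : 0 ≤ ε) {M : ℕ}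
    (h : ∀ x, ∃ n, 1 ≤ n ∧ n ≤ M ∧ visitCount T A x n ≤ ε * n) (N : ℕ) :
    ∀ x, visitCount T A x N ≤ ε * N + M := by
  induction N using Nat.strong_induction_on with
  | _ N ih =>
    intro x
    rcases le_or_gt N M with hNM | hNM
    · have h1 : (N : ℝ) ≤ M := by exact_mod_cast hNM
      have h2 : 0 ≤ ε * N := by positivity
      linarith [visitCount_le (T := T) (A := A) x N]
    · obtain ⟨n, h1, h2, h3⟩ := h x
      obtain ⟨k, rfl⟩ := Nat.exists_eq_add_of_le (h2.trans hNM.le)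
      rw [visitCount_add]
      have := ih k (by omega) (T^[n] x)
      push_cast
      linarith

/-- The points whose visits to `A` do not have positive lower density. -/
def rareVisitSet (T : X → X) (A : Set X) : Set X :=
  {x | ∀ j : ℕ, ∃ᶠ N : ℕ in atTop, visitCount T A x N < ((j : ℝ) + 1)⁻¹ * N}

theorem natLowerDensity_pos_of_notMem_rareVisitSet {x : X} (hx : x ∉ rareVisitSet T A) :
    0 < natLowerDensity {n | T^[n] x ∈ A} := by
  simp only [rareVisitSet, Set.mem_ofPred_eq, not_forall, not_frequently, not_lt] at hx
  obtain ⟨j, hj⟩ := hx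
  exact natLowerDensity_pos (by positivity) hj

theorem preimage_rareVisitSet : T ⁻¹' rareVisitSet T A = rareVisitSet T A := by
  have hT : ∀ x N, visitCount T A x (N + 1) = visitCount T A x 1 + visitCount T A (T x) N := by
    intro x N
    rw [add_comm N 1, visitCount_add]
    rfl
  -- the two counts differ by at most `1`, which is absorbed by doubling `ε = 1 / (j + 1)`
  have hj : ∀ j : ℕ, ((j : ℝ) + 1)⁻¹ = 2 * (((2 * j + 1 : ℕ) : ℝ) + 1)⁻¹ := by
    intro j
    push_cast
    field_simp
    ring
  ext x
  simp only [rareVisitSet, Set.mem_preimage, Set.mem_ofPred_eq]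
  constructor
  · intro h j
    have h1 : ∃ᶠ N : ℕ in atTop,
        visitCount T A x (N + 1) < ((j : ℝ) + 1)⁻¹ * ((N + 1 : ℕ) : ℝ) := by
      refine ((h (2 * j + 1)).and_eventually
        (eventually_ge_atTop (2 * j + 2))).mono fun N ⟨h1, h2⟩ => ?_
      have h3 := (visitCount_one_mem_Icc (T := T) (A := A) x).2
      have h4 : (1 : ℝ) ≤ (((2 * j + 1 : ℕ) : ℝ) + 1)⁻¹ * N := by
        rw [inv_mul_eq_div, le_div_iff₀ (by positivity), one_mul]
        exact_mod_cast h2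
      have h5 : (0 : ℝ) < (((2 * j + 1 : ℕ) : ℝ) + 1)⁻¹ := by positivity
      rw [hT, hj]
      push_cast at *
      linarith
    exact (tendsto_add_atTop_nat 1).frequently h1
  · intro h j
    have h0 := (h (2 * j + 1))
    rw [← map_add_atTop_eq_nat 1, frequently_map] at h0
    refine (h0.and_eventually (eventually_ge_atTop 1)).mono fun N ⟨h1, h2⟩ => ?_
    have h3 := (visitCount_one_mem_Icc (T := T) (A := A) x).1
    have h5 : (0 : ℝ) < (((2 * j + 1 : ℕ) : ℝ) + 1)⁻¹ := by positivity
    have h6 : (1 : ℝ) ≤ N := by exact_mod_cast h2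
    rw [hT] at h1
    rw [hj]
    push_cast at *
    nlinarith

variable [MeasurableSpace X]

theorem measurable_visitCount (hT : Measurable T) (hA : MeasurableSet A) (N : ℕ) :
    Measurable fun x => visitCount T A x N :=
  Finset.measurable_fun_sum _ fun k _ => measurable_const.indicator (hT.iterate k hA)

theorem measurableSet_rareVisitSet (hT : Measurable T) (hA : MeasurableSet A) :
    MeasurableSet (rareVisitSet T A) := by
  simp only [rareVisitSet, frequently_atTop, Set.ofPred_forall, Set.ofPred_exists, Set.ofPred_and]
  refine MeasurableSet.iInter fun j => MeasurableSet.iInter fun a =>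
    MeasurableSet.iUnion fun N => ?_
  exact (MeasurableSet.const _).inter
    (measurableSet_lt (measurable_visitCount hT hA N) measurable_const)

theorem integral_visitCount {μ : Measure X} [IsProbabilityMeasure μ] (hT : MeasurePreserving T μ μ)
    (hA : MeasurableSet A) (N : ℕ) : ∫ x, visitCount T A x N ∂μ = N * μ.real A := by
  simp only [visitCount]
  rw [integral_finsetSum _ fun k _ => (integrable_const (1 : ℝ)).indicator
    ((hT.iterate k).measurable hA)]
  have : ∀ k, ∫ x, (T^[k] ⁻¹' A).indicator (fun _ => (1 : ℝ)) x ∂μ = μ.real A := by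
    intro k
    rw [integral_indicator_const _ ((hT.iterate k).measurable hA), smul_eq_mul, mul_one,
      measureReal_def, (hT.iterate k).measure_preimage hA.nullMeasurableSet, measureReal_def]
  simp [this]

/-- If almost every point visits `A` rarely, then `A` is a null set. Outside a set of small measure
each orbit can be cut into pieces of bounded length along which the frequency of visits is small,
and integration of `visitCount_le_of_forall_exists` bounds `μ A`. -/
theorem measure_eq_zero_of_rareVisitSet {μ : Measure X} [IsProbabilityMeasure μ]
    (hT : MeasurePreserving T μ μ) (hA : MeasurableSet A) (h : μ (rareVisitSet T A) = 1) :
    μ A = 0 := by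
  by_contra hne
  have hpos : 0 < μ.real A := by
    rw [measureReal_def]
    exact ENNReal.toReal_pos hne (measure_ne_top _ _)
  obtain ⟨j, hj⟩ := exists_nat_one_div_lt hpos
  rw [one_div] at hj
  set ε : ℝ := ((j : ℝ) + 1)⁻¹ with hε
  have hε0 : 0 < ε := by positivity
  let G : ℕ → Set X := fun M => {x | ∃ n, 1 ≤ n ∧ n ≤ M ∧ visitCount T A x n ≤ ε * n}
  have hGm : ∀ M, MeasurableSet (G M) := by
    intro M
    simp only [G, Set.ofPred_exists, Set.ofPred_and]
    exact MeasurableSet.iUnion fun n => (MeasurableSet.const _).inter ((MeasurableSet.const _).inter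
      (measurableSet_le (measurable_visitCount hT.measurable hA n) measurable_const))
  have hGmono : Monotone G := fun M M' hM x ⟨n, h1, h2, h3⟩ => ⟨n, h1, h2.trans hM, h3⟩
  have hGU : μ (⋃ M, G M) = 1 := by
    refine le_antisymm prob_le_one (h ▸ measure_mono fun x hx => ?_)
    obtain ⟨n, h1, h2⟩ := frequently_atTop.1 (hx j) 1
    exact Set.mem_iUnion.2 ⟨n, n, h1, le_rfl, h2.le⟩
  have hlim : Tendsto (fun M => μ.real (A ∩ G M)) atTop (𝓝 (μ.real A)) := by
    have h1 := tendsto_measure_iUnion_atTop (μ := μ)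
      (fun _ _ h => Set.inter_subset_inter_right A (hGmono h) : Monotone fun M => A ∩ G M)
    rw [← Set.inter_iUnion, measure_inter_conull ((prob_compl_eq_zero_iff
      (MeasurableSet.iUnion hGm)).2 hGU)] at h1
    exact (ENNReal.tendsto_toReal (measure_ne_top _ _)).comp h1
  obtain ⟨M, hM, hM1⟩ := ((hlim.eventually (lt_mem_nhds hj)).and (eventually_ge_atTop 1)).exists
  have hcut : ∀ x, ∃ n, 1 ≤ n ∧ n ≤ M ∧ visitCount T (A ∩ G M) x n ≤ ε * n := by
    intro x
    by_cases hx : x ∈ G M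
    · obtain ⟨n, h1, h2, h3⟩ := hx
      exact ⟨n, h1, h2, (visitCount_mono Set.inter_subset_left x n).trans h3⟩
    · exact ⟨1, le_rfl, hM1, by simp [visitCount, hx, hε0.le]⟩
  have hbound : ∀ N : ℕ, N * (μ.real (A ∩ G M) - ε) ≤ M := by
    intro N
    have hm := hA.inter (hGm M)
    have h1 : ∫ x, visitCount T (A ∩ G M) x N ∂μ ≤ ∫ _x, (ε * N + M) ∂μ := by
      refine integral_mono ?_ (integrable_const _)
        (visitCount_le_of_forall_exists hε0.le hcut N)
      refine Integrable.of_bound (measurable_visitCount hT.measurable hm N).aestronglyMeasurable N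
        (ae_of_all _ fun x => ?_)
      rw [Real.norm_of_nonneg (visitCount_nonneg x N)]
      exact visitCount_le x N
    rw [integral_visitCount hT hm] at h1
    simp at h1
    linarith
  obtain ⟨N, hN⟩ := exists_nat_gt (M / (μ.real (A ∩ G M) - ε))
  rw [div_lt_iff₀ (by linarith)] at hN
  linarith [hbound N]

end Visits

theorem IsExactMeasure.ae_natLowerDensity_pos {X : Type*} [MeasurableSpace X] {T : X → X}
    {μ : Measure X} (h : IsExactMeasure T μ) {A : Set X} (hA : MeasurableSet A) (h0 : μ A ≠ 0) :
    ∀ᵐ x ∂μ, 0 < natLowerDensity {n | T^[n] x ∈ A} := by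
  have := h.isProbabilityMeasure
  have hm := measurableSet_rareVisitSet h.measurePreserving.measurable hA
  rcases h.trivial_tail (rareVisitSet T A) (fun n => ⟨_, hm, by
    induction n with
    | zero => rfl
    | succ n ih => rw [Function.iterate_succ, Set.preimage_comp, ih, preimage_rareVisitSet]⟩)
    with h1 | h1
  · filter_upwards [compl_mem_ae_iff.2 h1] with x hx
    exact natLowerDensity_pos_of_notMem_rareVisitSet hx
  · exact absurd (measure_eq_zero_of_rareVisitSet h.measurePreserving hA h1) h0

theorem natLowerDensity_mono {A B : Set ℕ} (h : A ⊆ B) : natLowerDensity A ≤ natLowerDensity B := by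
  classical
  have h1 : ∀ (A : Set ℕ) (N : ℕ),
      (((Finset.range N).filter (· ∈ A)).card : ℝ) / N ≤ 1 := fun A N => by
    refine div_le_one_of_le₀ ?_ (Nat.cast_nonneg N)
    exact_mod_cast (Finset.card_filter_le _ _).trans (Finset.card_range N).le
  unfold natLowerDensity
  refine liminf_le_liminf (Eventually.of_forall fun N => ?_) ?_ ?_
  · refine div_le_div_of_nonneg_right ?_ (Nat.cast_nonneg N)
    exact_mod_cast Finset.card_le_card fun k hk => by
      simp only [Finset.mem_filter] at hk ⊢
      exact ⟨hk.1, h hk.2⟩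
  · exact isBoundedUnder_of ⟨0, fun N => by positivity⟩
  · exact IsCoboundedUnder.of_frequently_le (a := 1) (Frequently.of_forall fun N => by
      convert h1 B N)

theorem IsExactMeasure.ae_isFrequentlyHypercyclicVector {X : Type*} [TopologicalSpace X]
    [SecondCountableTopology X] [MeasurableSpace X] [BorelSpace X] {T : X → X} {μ : Measure X}
    (h : IsExactMeasure T μ) (hsupp : ∀ U : Set X, IsOpen U → U.Nonempty → 0 < μ U) :
    ∀ᵐ x ∂μ, IsFrequentlyHypercyclicVector T x := by
  have hb := TopologicalSpace.isBasis_countableBasis X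
  have hall : ∀ᵐ x ∂μ, ∀ A ∈ TopologicalSpace.countableBasis X,
      0 < natLowerDensity {n | T^[n] x ∈ A} := by
    rw [ae_ball_iff (TopologicalSpace.countable_countableBasis X)]
    intro A hA
    exact h.ae_natLowerDensity_pos (hb.isOpen hA).measurableSet (hsupp A (hb.isOpen hA)
      (TopologicalSpace.nonempty_of_mem_countableBasis hA)).ne'
  filter_upwards [hall] with x hx U hU hne
  obtain ⟨y, hy⟩ := hne
  obtain ⟨A, hA, -, hAU⟩ := hb.exists_subset_of_mem_open hy hU
  exact (hx A hA).trans_le (natLowerDensity_mono fun n hn => hAU hn)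

/-! ### Random series as factors of the Bernoulli shift -/

section SequenceShift

variable {S : Type*}

/-- The `n`-fold left shift of sequences. -/
def seqShift (n : ℕ) (x : ℕ → S) : ℕ → S := fun k => x (k + n)

variable [MeasurableSpace S]

/-- The σ-algebra on the space of sequences generated by the `k`-th coordinate. -/
abbrev coordSigma (S : Type*) [MeasurableSpace S] (k : ℕ) : MeasurableSpace (ℕ → S) :=
  MeasurableSpace.comap (fun x => x k) inferInstance

theorem coordSigma_le (k : ℕ) : coordSigma S k ≤ MeasurableSpace.pi :=
  (measurable_pi_apply k).comap_le

theorem measurableSet_seqShift_preimage (n : ℕ) {B : Set (ℕ → S)} (hB : MeasurableSet B) :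
    MeasurableSet[⨆ k ∈ Set.Ici n, coordSigma S k] (seqShift n ⁻¹' B) := by
  have : Measurable[⨆ k ∈ Set.Ici n, coordSigma S k] (seqShift n : (ℕ → S) → ℕ → S) := by
    refine @measurable_pi_lambda _ _ _ (_) _ _ fun k => ?_
    have h : coordSigma S (k + n) ≤ ⨆ k ∈ Set.Ici n, coordSigma S k :=
      le_biSup (coordSigma S) (Set.mem_Ici.2 (Nat.le_add_left n k))
    have hk : Measurable[coordSigma S (k + n)] fun x : ℕ → S => x (k + n) :=
      Measurable.of_comap_le le_rfl
    exact hk.mono h le_rfl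
  exact this hB

variable (ν : Measure S) [IsProbabilityMeasure ν]

theorem iIndep_coordSigma : iIndep (coordSigma S) (Measure.infinitePi fun _ : ℕ => ν) :=
  (iIndepFun_iff_iIndep _ _ _).1
    (iIndepFun_infinitePi (P := fun _ : ℕ => ν) (X := fun _ x => x) fun _ => measurable_id)

theorem measurePreserving_seqShift (n : ℕ) :
    MeasurePreserving (seqShift n) (Measure.infinitePi fun _ : ℕ => ν)
      (Measure.infinitePi fun _ : ℕ => ν) where
  measurable := measurable_pi_lambda _ fun k => measurable_pi_apply (k + n)
  map_eq := Measure.map_infinitePi_infinitePi_of_inj (P := fun _ : ℕ => ν) (f := fun k => k + n)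
    (add_left_injective n)

/-- A version of Kolmogorov's zero-one law: it suffices that for every `n` the event coincides, up
to a null set, with one that does not depend on the first `n` coordinates. -/
theorem measure_zero_or_one_of_ae_eq_seqShift_preimage {A : Set (ℕ → S)}
    (h : ∀ n, ∃ B, MeasurableSet B ∧
      seqShift n ⁻¹' B =ᵐ[Measure.infinitePi fun _ : ℕ => ν] A) :
    Measure.infinitePi (fun _ : ℕ => ν) A = 0 ∨ Measure.infinitePi (fun _ : ℕ => ν) A = 1 := by
  choose B hB hBA using h
  let C : Set (ℕ → S) := ⋂ n, ⋃ k, seqShift (n + k) ⁻¹' B (n + k)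
  have hC : C =ᵐ[Measure.infinitePi fun _ : ℕ => ν] A := by
    have h1 := Filter.EventuallyEq.countable_iInter fun n =>
      Filter.EventuallyEq.countable_iUnion fun k => hBA (n + k)
    simpa only [Set.iUnion_const, Set.iInter_const] using h1
  have htail : MeasurableSet[limsup (coordSigma S) atTop] C := by
    rw [limsup_eq_iInf_iSup_of_nat, MeasurableSpace.measurableSet_iInf]
    intro N
    have hCN : C = ⋂ n, ⋃ k, seqShift (N + n + k) ⁻¹' B (N + n + k) := by
      refine Set.Subset.antisymm (Set.subset_iInter fun n => Set.iInter_subset _ (N + n))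
        (Set.subset_iInter fun n => ?_)
      refine (Set.iInter_subset _ n).trans (Set.iUnion_subset fun k => ?_)
      refine Set.subset_iUnion_of_subset (N + k) ?_
      rw [show N + n + k = n + (N + k) by ring]
    rw [hCN]
    refine MeasurableSet.iInter fun n => MeasurableSet.iUnion fun k => ?_
    refine (?_ : (⨆ i ∈ Set.Ici (N + n + k), coordSigma S i) ≤ _) _
      (measurableSet_seqShift_preimage _ (hB _))
    exact iSup₂_le fun i hi => le_biSup (coordSigma S) (show i ≥ N by
      have := Set.mem_Ici.1 hi
      omega)
  rw [← measure_congr hC]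
  exact measure_zero_or_one_of_measurableSet_limsup_atTop coordSigma_le (iIndep_coordSigma ν) htail

theorem measure_pi_inter_seqShift_preimage (N : ℕ) {t : ℕ → Set S} (ht : ∀ n, MeasurableSet (t n))
    {B : Set (ℕ → S)} (hB : MeasurableSet B) :
    Measure.infinitePi (fun _ : ℕ => ν) (Set.pi (Finset.range N) t ∩ seqShift N ⁻¹' B) =
      (∏ n ∈ Finset.range N, ν (t n)) * Measure.infinitePi (fun _ : ℕ => ν) B := by
  have hind := indep_iSup_of_disjoint coordSigma_le (iIndep_coordSigma ν)
    (S := Set.Iio N) (T := Set.Ici N)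
    (Set.disjoint_left.2 fun n h1 h2 => not_le.2 (Set.mem_Iio.1 h1) (Set.mem_Ici.1 h2))
  have hG : MeasurableSet[⨆ k ∈ Set.Iio N, coordSigma S k] (Set.pi (Finset.range N) t) := by
    rw [Set.pi_def]
    refine Finset.measurableSet_biInter _ fun n hn => ?_
    have h : coordSigma S n ≤ ⨆ k ∈ Set.Iio N, coordSigma S k :=
      le_biSup (coordSigma S) (Set.mem_Iio.2 (Finset.mem_range.1 hn))
    exact h _ ⟨t n, ht n, rfl⟩
  rw [(Indep_iff _ _ _).1 hind _ _ hG (measurableSet_seqShift_preimage N hB),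
    Measure.infinitePi_pi _ fun n _ => ht n,
    (measurePreserving_seqShift ν N).measure_preimage hB.nullMeasurableSet]

end SequenceShift

section RandomSeries

variable {𝕂 E : Type*} [RCLike 𝕂] [AddCommGroup E] [Module 𝕂 E]
  [UniformSpace E] [IsUniformAddGroup E] [ContinuousSMul 𝕂 E] [CompleteSpace E] [T2Space E]

omit [ContinuousSMul 𝕂 E] [CompleteSpace E] in
theorem seqShift_series {T : E →L[𝕂] E} {u : ℕ → E} (h0 : T (u 0) = 0)
    (hs : ∀ n, T (u (n + 1)) = u n) {x : ℕ → 𝕂} (hx : Summable fun n => x n • u n) (n : ℕ) :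
    (Summable fun k => seqShift n x k • u k) ∧
      (T : E → E)^[n] (∑' k, x k • u k) = ∑' k, seqShift n x k • u k := by
  induction n with
  | zero => exact ⟨hx, rfl⟩
  | succ n ih =>
    have hstep : ∀ k, T (seqShift n x (k + 1) • u (k + 1)) = seqShift (n + 1) x k • u k := by
      intro k
      rw [map_smul, hs, seqShift, seqShift, add_right_comm, add_assoc]
    have hsum : Summable fun k => T (seqShift n x k • u k) := ih.1.map T T.continuous
    refine ⟨((summable_nat_add_iff 1).2 hsum).congr hstep, ?_⟩
    rw [Function.iterate_succ_apply', ih.2, T.map_tsum ih.1, hsum.tsum_eq_zero_add]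
    simp only [hstep, map_smul, h0, smul_zero, zero_add]

variable {ν : Measure 𝕂}

omit [T2Space E] in
/-- By the Borel–Cantelli lemma, almost surely `‖x n‖ ≤ α n` for all large `n`, and bounded
multiplier convergence applies. -/
theorem ae_summable_smul [IsProbabilityMeasure ν] (hE : HasContractingBasis 𝕂 E) {u : ℕ → E}
    {α : ℕ → ℝ} (hu : Summable fun n => (α n : 𝕂) • u n) (hα : ∑' n, ν {z | α n < ‖z‖} ≠ ⊤) :
    ∀ᵐ x ∂(Measure.infinitePi fun _ : ℕ => ν), Summable fun n => x n • u n := by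
  have h1 : ∀ n, Measure.infinitePi (fun _ : ℕ => ν) {x : ℕ → 𝕂 | α n < ‖x n‖} =
      ν {z | α n < ‖z‖} := fun n =>
    (measurePreserving_eval_infinitePi (fun _ : ℕ => ν) n).measure_preimage
      (measurableSet_lt measurable_const measurable_norm).nullMeasurableSet
  have h2 := ae_eventually_notMem (μ := Measure.infinitePi fun _ : ℕ => ν)
    (s := fun n => {x : ℕ → 𝕂 | α n < ‖x n‖}) (by simpa only [h1] using hα)
  filter_upwards [h2] with x hx
  exact hu.smul_of_eventually_norm_le hE (hx.mono fun n hn => not_lt.1 hn)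

variable [(uniformity E).IsCountablyGenerated] [MeasurableSpace E] [BorelSpace E]

theorem aemeasurable_series {u : ℕ → E}
    (h : ∀ᵐ x ∂(Measure.infinitePi fun _ : ℕ => ν), Summable fun n => x n • u n) :
    AEMeasurable (fun x : ℕ → 𝕂 => ∑' n, x n • u n) (Measure.infinitePi fun _ : ℕ => ν) := by
  refine aemeasurable_of_tendsto_metrizable_ae atTop
    (f := fun (N : ℕ) (x : ℕ → 𝕂) => ∑ n ∈ Finset.range N, x n • u n) (fun N => ?_) ?_
  · have : Continuous fun x : ℕ → 𝕂 => ∑ n ∈ Finset.range N, x n • u n := by fun_prop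
    exact this.measurable.aemeasurable
  · filter_upwards [h] with x hx
    exact hx.hasSum.tendsto_sum_nat

theorem isExactMeasure_map_series [IsProbabilityMeasure ν] {T : E →L[𝕂] E} {u : ℕ → E}
    (h0 : T (u 0) = 0) (hs : ∀ n, T (u (n + 1)) = u n)
    (h : ∀ᵐ x ∂(Measure.infinitePi fun _ : ℕ => ν), Summable fun n => x n • u n) :
    IsExactMeasure T ((Measure.infinitePi fun _ : ℕ => ν).map
      fun x : ℕ → 𝕂 => ∑' n, x n • u n) := by
  have hm := aemeasurable_series h
  have hTm : Measurable T := T.continuous.measurable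
  refine ⟨Measure.isProbabilityMeasure_map hm, ⟨hTm, ?_⟩, fun A hA => ?_⟩
  · have hp := measurePreserving_seqShift ν 1
    calc ((Measure.infinitePi fun _ : ℕ => ν).map fun x : ℕ → 𝕂 => ∑' n, x n • u n).map T
        = (Measure.infinitePi fun _ : ℕ => ν).map
            ((fun x : ℕ → 𝕂 => ∑' n, x n • u n) ∘ seqShift 1) := by
          rw [AEMeasurable.map_map_of_aemeasurable hTm.aemeasurable hm]
          refine Measure.map_congr ?_
          filter_upwards [h] with x hx
          exact (seqShift_series h0 hs hx 1).2
      _ = _ := by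
          rw [← AEMeasurable.map_map_of_aemeasurable (by rwa [hp.map_eq]) hp.aemeasurable,
            hp.map_eq]
  · obtain ⟨A', hA', rfl⟩ := hA 0
    rw [Function.iterate_zero, Set.preimage_id] at hA ⊢
    rw [Measure.map_apply_of_aemeasurable hm hA']
    refine measure_zero_or_one_of_ae_eq_seqShift_preimage ν fun n => ?_
    obtain ⟨B, hB, hBA⟩ := hA n
    refine ⟨hm.mk _ ⁻¹' B, hm.measurable_mk hB, ?_⟩
    have hmk := (measurePreserving_seqShift ν n).quasiMeasurePreserving.ae hm.ae_eq_mk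
    filter_upwards [h, hmk] with x hx hxn
    refine propext ?_
    change hm.mk _ (seqShift n x) ∈ B ↔ _ ∈ A'
    rw [← hxn, ← (seqShift_series h0 hs hx n).2, ← hBA]
    rfl

/-- The law of the series charges every nonempty open set `U`: some finite combination
`∑_{n < N} c n • u n` lies in `U`; with positive probability the coordinates below `N` are close
to those of `c`, and, independently, the tail of the series is close to `0` if `N` is large. -/
theorem measure_map_series_pos [IsProbabilityMeasure ν] [ν.IsOpenPosMeasure]
    (hE : HasContractingBasis 𝕂 E) {u : ℕ → E}
    {α : ℕ → ℝ} (hu : Summable fun n => (α n : 𝕂) • u n) (hα : ∑' n, ν {z | α n < ‖z‖} ≠ ⊤)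
    (hd : Dense (Submodule.span 𝕂 (Set.range u) : Set E)) {U : Set E} (hU : IsOpen U)
    (hne : U.Nonempty) :
    0 < (Measure.infinitePi fun _ : ℕ => ν).map (fun x : ℕ → 𝕂 => ∑' n, x n • u n) U := by
  have hsum := ae_summable_smul hE hu hα
  have hm := aemeasurable_series hsum
  rw [Measure.map_apply_of_aemeasurable hm hU.measurableSet]
  obtain ⟨y, hyU, hy⟩ := hd.exists_mem_open hU hne
  obtain ⟨c, rfl⟩ := Finsupp.mem_span_range_iff_exists_finsupp.1 hyU
  obtain ⟨W, hW, V, hV, hV0, hWV⟩ : ∃ W ∈ 𝓝 (c.sum fun i a => a • u i), ∃ V : Set E, IsOpen V ∧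
      (0 : E) ∈ V ∧ ∀ a ∈ W, ∀ b ∈ V, a + b ∈ U := by
    have h1 : (fun p : E × E => p.1 + p.2) ⁻¹' U ∈ 𝓝 ((c.sum fun i a => a • u i), (0 : E)) :=
      continuous_add.continuousAt.preimage_mem_nhds (hU.mem_nhds (by simpa using hy))
    obtain ⟨W, hW, V, hV, hsub⟩ := mem_nhds_prod_iff.1 h1
    obtain ⟨V', hV'V, hV', h0⟩ := mem_nhds_iff.1 hV
    exact ⟨W, hW, V', hV', h0, fun a ha b hb => hsub (Set.mk_mem_prod ha (hV'V hb))⟩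
  have hsplit : ∀ N, ∀ x : ℕ → 𝕂, (Summable fun n => x n • u n) →
      ∑' n, x n • u n = ∑ n ∈ Finset.range N, x n • u n + ∑' k, seqShift N x k • u (k + N) :=
    fun N x hx => (hx.sum_add_tsum_nat_add N).symm
  obtain ⟨N, hcN, hN⟩ : ∃ N, c.support ⊆ Finset.range N ∧
      Measure.infinitePi (fun _ : ℕ => ν) {x | ∑' k, seqShift N x k • u (k + N) ∈ V} ≠ 0 := by
    by_contra! hcon
    have h1 : ∀ᵐ x ∂(Measure.infinitePi fun _ : ℕ => ν), ∀ N, c.support ⊆ Finset.range N →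
        ∑' k, seqShift N x k • u (k + N) ∉ V := by
      rw [ae_all_iff]
      intro N
      by_cases hN : c.support ⊆ Finset.range N
      · filter_upwards [compl_mem_ae_iff.2 (hcon N hN)] with x hx _ using hx
      · exact ae_of_all _ fun x h => absurd h hN
    obtain ⟨x, hx, hxs⟩ := (h1.and hsum).exists
    have h2 : Tendsto (fun N => ∑' k, seqShift N x k • u (k + N)) atTop (𝓝 0) :=
      tendsto_sum_nat_add fun n => x n • u n
    obtain ⟨M, hM⟩ := c.support.exists_nat_subset_range
    obtain ⟨N, hN, hMN⟩ := ((h2.eventually (hV.mem_nhds hV0)).and (eventually_ge_atTop M)).exists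
    exact hx N (hM.trans (Finset.range_subset_range.2 hMN)) hN
  obtain ⟨t, htm, htpos, htW⟩ : ∃ t : ℕ → Set 𝕂, (∀ n, MeasurableSet (t n)) ∧ (∀ n, ν (t n) ≠ 0) ∧
      ∀ x ∈ Set.pi (Finset.range N) t, ∑ n ∈ Finset.range N, x n • u n ∈ W := by
    have hcont : Continuous fun x : ℕ → 𝕂 => ∑ n ∈ Finset.range N, x n • u n := by fun_prop
    have h1 := hcont.continuousAt.preimage_mem_nhds (x := ⇑c) (t := W) (by
      rwa [← Finsupp.sum_of_support_subset c hcN (fun i a => a • u i) fun _ _ => zero_smul _ _])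
    rw [nhds_pi, Filter.mem_pi] at h1
    obtain ⟨I, -, t, ht, hsub⟩ := h1
    refine ⟨fun n => interior (t n), fun n => isOpen_interior.measurableSet,
      fun n => (isOpen_interior.measure_pos ν ⟨c n, mem_interior_iff_mem_nhds.2 (ht n)⟩).ne',
      fun x hx => ?_⟩
    -- coordinates beyond `N` do not matter, so they may be taken from `c`
    let x' : ℕ → 𝕂 := fun n => if n < N then x n else c n
    have h2 : ∑ n ∈ Finset.range N, x' n • u n = ∑ n ∈ Finset.range N, x n • u n :=
      Finset.sum_congr rfl fun n hn => by simp only [x', if_pos (Finset.mem_range.1 hn)]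
    rw [← h2]
    refine hsub fun n _ => ?_
    by_cases hn : n < N
    · simp only [x', if_pos hn]
      exact interior_subset (hx n (by simpa using hn))
    · simp only [x', if_neg hn]
      exact mem_of_mem_nhds (ht n)
  have htail : ∀ᵐ x ∂(Measure.infinitePi fun _ : ℕ => ν), Summable fun k => x k • u (k + N) := by
    refine ae_summable_smul hE (α := fun k => α (k + N))
      ((summable_nat_add_iff (f := fun n => (α n : 𝕂) • u n) N).2 hu) (ne_top_of_le_ne_top hα ?_)
    exact ENNReal.tsum_comp_le_tsum_of_injective (add_left_injective N) fun n => ν {z | α n < ‖z‖}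
  have hψ := aemeasurable_series htail
  have hmk := (measurePreserving_seqShift ν N).quasiMeasurePreserving.ae hψ.ae_eq_mk
  have hpos : 0 < Measure.infinitePi (fun _ : ℕ => ν)
      (Set.pi (Finset.range N) t ∩ seqShift N ⁻¹' (hψ.mk _ ⁻¹' V)) := by
    rw [measure_pi_inter_seqShift_preimage ν N htm (hψ.measurable_mk hV.measurableSet)]
    refine pos_iff_ne_zero.2 (mul_ne_zero (Finset.prod_ne_zero_iff.2 fun n _ => htpos n) ?_)
    rw [← (measurePreserving_seqShift ν N).measure_preimage
      (hψ.measurable_mk hV.measurableSet).nullMeasurableSet]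
    refine fun h => hN ?_
    rw [← h]
    refine measure_congr ?_
    filter_upwards [hmk] with x hx
    refine propext ?_
    change _ ∈ V ↔ hψ.mk _ (seqShift N x) ∈ V
    rw [← hx]
  refine hpos.trans_le (measure_mono_ae ?_)
  filter_upwards [hsum, hmk] with x hx hxN hxmem
  change ∑' n, x n • u n ∈ U
  rw [hsplit N x hx]
  refine hWV _ (htW x hxmem.1) _ ?_
  change ∑' k, seqShift N x k • u (k + N) = _ at hxN
  rw [hxN]
  exact hxmem.2

/-- All properties of the random series depend only on the joint law of the coefficients, so they
are transported from the coordinates on the canonical product space. -/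
theorem isExactFHCSeries_of_tsum_ne_top [IsProbabilityMeasure ν] [ν.IsOpenPosMeasure]
    (hE : HasContractingBasis 𝕂 E) {T : E →L[𝕂] E} {u : ℕ → E} (h0 : T (u 0) = 0)
    (hs : ∀ n, T (u (n + 1)) = u n) (hd : Dense (Submodule.span 𝕂 (Set.range u) : Set E))
    {α : ℕ → ℝ} (hu : Summable fun n => (α n : 𝕂) • u n) (hα : ∑' n, ν {z | α n < ‖z‖} ≠ ⊤)
    {Ω : Type*} [MeasurableSpace Ω] {P : Measure Ω} {Y : ℕ → Ω → 𝕂}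
    (hY : AEMeasurable (fun ω n => Y n ω) P)
    (hlaw : P.map (fun ω n => Y n ω) = Measure.infinitePi fun _ : ℕ => ν) :
    IsExactFHCSeries T u Y P := by
  have hsum := ae_summable_smul hE hu hα
  have hm := aemeasurable_series hsum
  have hexact := isExactMeasure_map_series h0 hs hsum
  have hsupp := fun U => measure_map_series_pos hE hu hα hd (U := U)
  have : TopologicalSpace.SeparableSpace E := by
    rw [← TopologicalSpace.isSeparable_univ_iff, ← hd.closure_eq]
    exact ((Set.countable_range u).isSeparable.span (R := 𝕂)).closure
  have : SecondCountableTopology E := UniformSpace.secondCountable_of_separable E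
  have hmap : P.map (fun ω => ∑' n, Y n ω • u n) =
      (Measure.infinitePi fun _ : ℕ => ν).map fun x : ℕ → 𝕂 => ∑' n, x n • u n := by
    rw [← hlaw] at hm ⊢
    rw [AEMeasurable.map_map_of_aemeasurable hm hY]
    rfl
  have hmY : AEMeasurable (fun ω => ∑' n, Y n ω • u n) P := by
    rw [← hlaw] at hm
    exact hm.comp_aemeasurable hY
  refine ⟨_, hmY, ?_, ?_, hmap ▸ hexact, hmap ▸ hsupp⟩
  · rw [← hlaw] at hsum
    filter_upwards [ae_of_ae_map hY hsum] with ω hω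
    exact hω.hasSum.tendsto_sum_nat
  · have h := hexact.ae_isFrequentlyHypercyclicVector hsupp
    rw [← hmap] at h
    exact ae_of_ae_map hmY h

end RandomSeries

/-! ### Tails and supports of scalar laws -/

section Laws

variable {𝕂 : Type*} [RCLike 𝕂]

/-- A Gaussian tail decays at a summable rate along multiples of `√(log n)`. -/
theorem exists_tsum_measure_lt_norm_ne_top {ν : Measure 𝕂} [IsProbabilityMeasure ν] {c K : ℝ}
    (hc : 0 < c) (h : ∀ t : ℝ, 0 ≤ t → ν.real {z | t ≤ ‖z‖} ≤ K * Real.exp (-c * t ^ 2)) :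
    ∃ M : ℝ, ∑' n : ℕ, ν {z | M * √(Real.log n) < ‖z‖} ≠ ⊤ := by
  -- `M` is chosen so that `c * M ^ 2 = 2`, which makes the `n`-th probability at most `K / n ^ 2`
  refine ⟨√(2 / c), ?_⟩
  have hlog : ∀ n : ℕ, 0 ≤ Real.log n := fun n => Real.log_natCast_nonneg n
  have hexp : ∀ n : ℕ, -c * (√(2 / c) * √(Real.log n)) ^ 2 = -(2 * Real.log n) := by
    intro n
    rw [mul_pow, Real.sq_sqrt (by positivity), Real.sq_sqrt (hlog n)]
    field_simp
  have hs : Summable fun n : ℕ => K * Real.exp (-(2 * Real.log n)) := by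
    refine Summable.mul_left K ?_
    rw [← summable_nat_add_iff 1]
    refine ((summable_nat_add_iff 1).2 (Real.summable_nat_pow_inv.2 (one_lt_two))).congr fun n => ?_
    have hn : (0 : ℝ) < ((n + 1 : ℕ) : ℝ) := by positivity
    rw [Real.exp_neg, two_mul, Real.exp_add, Real.exp_log hn, sq]
  refine ne_top_of_le_ne_top hs.tsum_ofReal_ne_top (ENNReal.tsum_le_tsum fun n => ?_)
  have h1 := h (√(2 / c) * √(Real.log n)) (by positivity)
  rw [hexp] at h1
  calc ν {z | √(2 / c) * √(Real.log n) < ‖z‖} ≤ ν {z | √(2 / c) * √(Real.log n) ≤ ‖z‖} :=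
        by
        refine measure_mono fun z hz => ?_
        simp only [Set.mem_ofPred_eq] at hz ⊢
        exact hz.le
    _ = ENNReal.ofReal (ν.real {z | √(2 / c) * √(Real.log n) ≤ ‖z‖}) := by
        rw [measureReal_def, ENNReal.ofReal_toReal (measure_ne_top _ _)]
    _ ≤ _ := ENNReal.ofReal_le_ofReal h1

theorem ProbabilityTheory.IsGaussian.exists_measure_norm_le {ν : Measure 𝕂} [IsGaussian ν] :
    ∃ c : ℝ, 0 < c ∧ ∃ K : ℝ,
      ∀ t : ℝ, 0 ≤ t → ν.real {z | t ≤ ‖z‖} ≤ K * Real.exp (-c * t ^ 2) := by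
  obtain ⟨c, hc, hint⟩ := IsGaussian.exists_integrable_exp_sq ν
  refine ⟨c, hc, ∫ z, Real.exp (c * ‖z‖ ^ 2) ∂ν, fun t ht => ?_⟩
  have h1 := mul_meas_ge_le_integral_of_nonneg
    (ae_of_all ν fun z => (Real.exp_pos (c * ‖z‖ ^ 2)).le) hint (Real.exp (c * t ^ 2))
  have h2 : ν.real {z | t ≤ ‖z‖} ≤ ν.real {z | Real.exp (c * t ^ 2) ≤ Real.exp (c * ‖z‖ ^ 2)} := by
    refine measureReal_mono (fun z (hz : t ≤ ‖z‖) => ?_) (measure_ne_top _ _)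
    change Real.exp _ ≤ Real.exp _
    gcongr
  rw [neg_mul, Real.exp_neg, ← div_eq_mul_inv, le_div_iff₀ (Real.exp_pos _), mul_comm]
  exact (mul_le_mul_of_nonneg_left h2 (Real.exp_pos _).le).trans h1

variable {Ω : Type*} [MeasurableSpace Ω] {P : Measure Ω}

theorem gaussianReal_isOpenPosMeasure (m : ℝ) {v : NNReal} (hv : v ≠ 0) :
    (gaussianReal m v).IsOpenPosMeasure :=
  (gaussianReal_absolutelyContinuous' m hv).isOpenPosMeasure

theorem ProbabilityTheory.HasGaussianLaw.variance_ne_zero {Z : Ω → ℝ} (h : HasGaussianLaw Z P)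
    (hZ : ¬ ∃ c : ℝ, ∀ᵐ ω ∂P, Z ω = c) : Var[Z; P] ≠ 0 := by
  intro h0
  have := h.isProbabilityMeasure
  refine hZ ⟨P[Z], ?_⟩
  refine (evariance_eq_zero_iff h.aemeasurable).1 ?_
  rw [← h.memLp_two.ofReal_variance_eq, h0, ENNReal.ofReal_zero]

theorem ProbabilityTheory.HasGaussianLaw.isOpenPosMeasure_map {Z : Ω → ℝ} (h : HasGaussianLaw Z P)
    (hZ : ¬ ∃ c : ℝ, ∀ᵐ ω ∂P, Z ω = c) : (P.map Z).IsOpenPosMeasure := by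
  have := h.isProbabilityMeasure
  rw [h.map_eq_gaussianReal]
  refine gaussianReal_isOpenPosMeasure _ ?_
  have h1 := h.variance_ne_zero hZ
  have h2 := variance_nonneg Z P
  simpa [Real.toNNReal_eq_zero] using lt_of_le_of_ne h2 h1.symm

/-- A Gaussian variable which is not concentrated on a real affine line charges every open set:
`Re X` and `Im X - a * Re X` are independent for a suitable `a`, and neither is constant. -/
theorem IsNonconstantGaussian.isOpenPosMeasure_map {X : Ω → 𝕂} (h : IsNonconstantGaussian X P) :
    (P.map X).IsOpenPosMeasure := by
  have hX := h.gaussian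
  have := hX.isProbabilityMeasure
  have hre : (RCLike.reCLM : 𝕂 →L[ℝ] ℝ) ≠ 0 := fun h0 => by
    have := DFunLike.congr_fun h0 (1 : 𝕂)
    simp at this
  have hRe : HasGaussianLaw (fun ω => RCLike.re (X ω)) P := hX.map_fun RCLike.reCLM
  have hRe0 : ¬ ∃ c : ℝ, ∀ᵐ ω ∂P, RCLike.re (X ω) = c := h.nonconstant RCLike.reCLM hre
  have hReO := hRe.isOpenPosMeasure_map hRe0
  rcases RCLike.I_eq_zero_or_im_I_eq_one (K := 𝕂) with hI | hI
  · have hX' : X = (fun r : ℝ => (r : 𝕂)) ∘ fun ω => RCLike.re (X ω) := by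
      funext ω
      conv_lhs => rw [← RCLike.re_add_im (X ω), hI, mul_zero, add_zero]
      rfl
    rw [hX', ← AEMeasurable.map_map_of_aemeasurable
      RCLike.continuous_ofReal.measurable.aemeasurable hRe.aemeasurable]
    refine RCLike.continuous_ofReal.isOpenPosMeasure_map fun z => ⟨RCLike.re z, ?_⟩
    conv_rhs => rw [← RCLike.re_add_im z, hI, mul_zero, add_zero]
  · set a : ℝ := cov[fun ω => RCLike.re (X ω), fun ω => RCLike.im (X ω); P] /
      Var[fun ω => RCLike.re (X ω); P] with ha
    let L : 𝕂 →L[ℝ] ℝ := RCLike.imCLM - a • RCLike.reCLM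
    have hL : L ≠ 0 := fun h0 => by
      have := DFunLike.congr_fun h0 (RCLike.I : 𝕂)
      simp [L, hI] at this
    have hIm : HasGaussianLaw (fun ω => RCLike.im (X ω)) P := hX.map_fun RCLike.imCLM
    have hLO := (hX.map_fun L).isOpenPosMeasure_map (h.nonconstant L hL)
    have hpair : HasGaussianLaw (fun ω => (RCLike.re (X ω), L (X ω))) P :=
      hX.map_fun (RCLike.reCLM.prod L)
    have hLX : (fun ω => L (X ω)) = (fun ω => RCLike.im (X ω)) - fun ω => a * RCLike.re (X ω) := by
      funext ω
      simp [L]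
    have hind := hpair.indepFun_of_covariance_eq_zero (by
      rw [hLX, covariance_sub_right hRe.memLp_two hIm.memLp_two (hRe.memLp_two.const_mul a),
        covariance_const_mul_right, covariance_self hRe.aemeasurable, ha,
        div_mul_cancel₀ _ (hRe.variance_ne_zero hRe0), sub_self])
    have hprod := (indepFun_iff_map_prod_eq_prod_map_map hRe.aemeasurable
      (hX.map_fun L).aemeasurable).1 hind
    let Φ : ℝ × ℝ → 𝕂 := fun p => (p.1 : 𝕂) + ((p.2 + a * p.1 : ℝ) : 𝕂) * RCLike.I
    have hΦ : Continuous Φ := by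
      have h1 : Continuous (RCLike.ofReal : ℝ → 𝕂) := RCLike.continuous_ofReal
      fun_prop
    have hΦs : ∀ z : 𝕂, Φ (RCLike.re z, L z) = z := by
      intro z
      conv_rhs => rw [← RCLike.re_add_im z]
      simp [Φ, L]
    have hX' : X = Φ ∘ fun ω => (RCLike.re (X ω), L (X ω)) := by
      funext ω
      exact (hΦs (X ω)).symm
    rw [hX', ← AEMeasurable.map_map_of_aemeasurable hΦ.measurable.aemeasurable hpair.aemeasurable,
      hprod]
    have := Measure.isProbabilityMeasure_map (μ := P) hRe.aemeasurable
    have := Measure.isProbabilityMeasure_map (μ := P) (hX.map_fun L).aemeasurable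
    exact hΦ.isOpenPosMeasure_map fun z => ⟨_, hΦs z⟩

theorem HasFullSupport.isOpenPosMeasure_map {X : Ω → 𝕂} (hX : AEMeasurable X P)
    (h : HasFullSupport X P) : (P.map X).IsOpenPosMeasure := by
  refine ⟨fun U hU hne => ?_⟩
  rw [Measure.map_apply_of_aemeasurable hX hU.measurableSet]
  exact (h U hU hne).ne'

/-- A variable with full support whose tail is as light as prescribed: it enumerates a dense
sequence `d` with weights `p j` such that `∑ p j * #{n | α n < ‖d j‖}` is finite. -/
theorem exists_hasFullSupport_tsum_ne_top (𝕂 : Type*) [RCLike 𝕂] {α : ℕ → ℝ}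
    (hα : Tendsto α atTop atTop) :
    ∃ (Ω₀ : Type) (_ : MeasurableSpace Ω₀) (P₀ : Measure Ω₀) (_ : IsProbabilityMeasure P₀)
      (X : Ω₀ → 𝕂), Measurable X ∧ HasFullSupport X P₀ ∧
        ∑' n, P₀.map X {z | α n < ‖z‖} ≠ ⊤ := by
  classical
  let d : ℕ → 𝕂 := TopologicalSpace.denseSeq 𝕂
  have hfin : ∀ j, {n | α n < ‖d j‖}.Finite := by
    intro j
    have h1 := hα.eventually_ge_atTop ‖d j‖
    rw [← Nat.cofinite_eq_atTop, eventually_cofinite] at h1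
    simpa only [not_le] using h1
  let C : ℕ → ℕ := fun j => (hfin j).toFinset.card
  let q : ℕ → ENNReal := fun j => 2⁻¹ ^ j * ((C j : ENNReal) + 1)⁻¹
  have hgeom : ∑' j : ℕ, (2⁻¹ : ENNReal) ^ j ≠ ⊤ := by
    rw [ENNReal.tsum_geometric]
    simp
  have hq0 : ∀ j, q j ≠ 0 := fun j =>
    mul_ne_zero (pow_ne_zero _ (by simp)) (ENNReal.inv_ne_zero.2 (by finiteness))
  have hqC : ∀ j, q j * C j ≤ 2⁻¹ ^ j := by
    intro j
    rw [mul_assoc]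
    refine mul_le_of_le_one_right' ?_
    rw [mul_comm, ← div_eq_mul_inv]
    exact ENNReal.div_le_of_le_mul (by simp)
  have hqle : ∀ j, q j ≤ 2⁻¹ ^ j := fun j =>
    mul_le_of_le_one_right' (ENNReal.inv_le_one.2 le_add_self)
  have hqs : ∑' j, q j ≠ ⊤ := ne_top_of_le_ne_top hgeom (ENNReal.tsum_le_tsum hqle)
  have hqs0 : ∑' j, q j ≠ 0 := fun h => hq0 0 (ENNReal.tsum_eq_zero.1 h 0)
  let p : PMF ℕ := PMF.normalize q hqs0 hqs
  have hp : ∀ j, p j = q j * (∑' i, q i)⁻¹ := fun j => PMF.normalize_apply hqs0 hqs j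
  refine ⟨ℕ, ⊤, p.toMeasure, inferInstance, d, measurable_from_top, fun U hU hne => ?_, ?_⟩
  · obtain ⟨j, hj⟩ := (TopologicalSpace.denseRange_denseSeq 𝕂).exists_mem_open hU hne
    rw [PMF.toMeasure_apply _ MeasurableSpace.measurableSet_top]
    refine pos_iff_ne_zero.2 fun h0 => ?_
    have h1 := ENNReal.tsum_eq_zero.1 h0 j
    rw [Set.indicator_of_mem (Set.mem_preimage.2 hj), hp] at h1
    exact mul_ne_zero (hq0 j) (ENNReal.inv_ne_zero.2 hqs) h1
  · have h1 : ∀ n, p.toMeasure.map d {z | α n < ‖z‖} =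
        ∑' j, if α n < ‖d j‖ then p j else 0 := by
      intro n
      rw [Measure.map_apply measurable_from_top
        (measurableSet_lt measurable_const measurable_norm),
        PMF.toMeasure_apply _ MeasurableSpace.measurableSet_top]
      rfl
    have h2 : ∀ j, (∑' n, if α n < ‖d j‖ then p j else 0) = q j * C j * (∑' i, q i)⁻¹ := by
      intro j
      rw [tsum_eq_sum (s := (hfin j).toFinset) fun n hn => by
        simpa using fun h => absurd h (by simpa using hn), Finset.sum_congr rfl fun n hn =>
        if_pos (by simpa using hn), Finset.sum_const, nsmul_eq_mul, hp]
      ring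
    simp only [h1]
    rw [ENNReal.tsum_comm]
    simp only [h2]
    rw [ENNReal.tsum_mul_right]
    exact ENNReal.mul_ne_top (ne_top_of_le_ne_top hgeom (ENNReal.tsum_le_tsum hqC))
      (ENNReal.inv_ne_top.2 hqs0)

end Laws

/-! ### Weighted shifts -/

section WeightedShift

variable {𝕂 E : Type*} [RCLike 𝕂] [AddCommGroup E] [Module 𝕂 E] [TopologicalSpace E]
  {e : ℕ → E} {w : ℕ → 𝕂} {T : E →L[𝕂] E}

theorem shiftBeta_succ (w : ℕ → 𝕂) (n : ℕ) : shiftBeta w (n + 1) = shiftBeta w n * w (n + 1) :=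
  Finset.prod_Icc_succ_top (by omega) _

theorem IsUnilateralWeightedShift.shiftBeta_ne_zero (hT : IsUnilateralWeightedShift e w T) (n : ℕ) :
    shiftBeta w n ≠ 0 :=
  Finset.prod_ne_zero_iff.2 fun k hk => hT.weight_ne_zero k (Finset.mem_Icc.1 hk).1

theorem IsUnilateralWeightedShift.map_inv_shiftBeta_smul_zero
    (hT : IsUnilateralWeightedShift e w T) :
    T ((shiftBeta w 0)⁻¹ • e 0) = 0 := by
  rw [map_smul, hT.map_unit_zero, smul_zero]

theorem IsUnilateralWeightedShift.map_inv_shiftBeta_smul_succ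
    (hT : IsUnilateralWeightedShift e w T) (n : ℕ) :
    T ((shiftBeta w (n + 1))⁻¹ • e (n + 1)) = (shiftBeta w n)⁻¹ • e n := by
  rw [map_smul, hT.map_unit_succ, smul_smul, shiftBeta_succ, mul_inv, mul_assoc,
    inv_mul_cancel₀ (hT.weight_ne_zero _ (by omega)), mul_one]

theorem IsUnilateralWeightedShift.dense_span (hT : IsUnilateralWeightedShift e w T)
    (hd : Dense (Submodule.span 𝕂 (Set.range e) : Set E)) :
    Dense (Submodule.span 𝕂 (Set.range fun n => (shiftBeta w n)⁻¹ • e n) : Set E) := by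
  refine hd.mono (Submodule.span_le.2 ?_)
  rintro _ ⟨n, rfl⟩
  have h : e n = shiftBeta w n • (shiftBeta w n)⁻¹ • e n := by
    rw [smul_smul, mul_inv_cancel₀ (hT.shiftBeta_ne_zero n), one_smul]
  rw [SetLike.mem_coe, h]
  exact Submodule.smul_mem _ _ (Submodule.subset_span ⟨n, rfl⟩)

end WeightedShift

theorem IsIIDCopies.aemeasurable_and_map_eq {𝕂 Ω Ω' : Type*} [RCLike 𝕂] [MeasurableSpace Ω]
    [MeasurableSpace Ω'] {Y : ℕ → Ω' → 𝕂} {P' : Measure Ω'} {X : Ω → 𝕂} {P : Measure Ω}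
    (h : IsIIDCopies Y P' X P) :
    AEMeasurable (fun ω n => Y n ω) P' ∧
      P'.map (fun ω n => Y n ω) = Measure.infinitePi fun _ : ℕ => P.map X := by
  have hm := fun n => (h.identDistrib n).aemeasurable_fst
  refine ⟨aemeasurable_pi_iff.2 hm, ?_⟩
  rw [h.indep.map_fun_eq_infinitePi_map₀' hm]
  simp only [fun n => (h.identDistrib n).map_eq]

theorem mainTheorem2 {𝕂 : Type*} [RCLike 𝕂]
    -- `E` is an F-space: a complete metrizable topological vector space over `𝕂`
    {E : Type*} [AddCommGroup E] [Module 𝕂 E] [Module ℝ E] [IsScalarTower ℝ 𝕂 E]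
    [UniformSpace E] [IsUniformAddGroup E] [ContinuousSMul 𝕂 E] [CompleteSpace E] [T2Space E]
    [(uniformity E).IsCountablyGenerated] [MeasurableSpace E] [BorelSpace E]
    -- `E` is locally bounded or locally convex
    (hE : IsLocallyBoundedSpace 𝕂 E ∨ LocallyConvexSpace ℝ E)
    -- `E` is a sequence space: it embeds linearly and continuously into `𝕂^ℕ`
    (coord : E →L[𝕂] (ℕ → 𝕂)) (hcoord : Function.Injective coord)
    -- the canonical unit sequences lie in `E` and span a dense subspace
    (e : ℕ → E) (he : ∀ n, coord (e n) = Pi.single n 1)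
    (hdense : Dense (Submodule.span 𝕂 (Set.range e) : Set E))
    (T : E →L[𝕂] E) (w : ℕ → 𝕂) (hT : IsUnilateralWeightedShift e w T) :
    (Summable (fun n : ℕ => (shiftBeta w n)⁻¹ • e n) →
      ∃ (Ω₀ : Type) (_ : MeasurableSpace Ω₀) (P₀ : Measure Ω₀) (_ : IsProbabilityMeasure P₀)
        (X : Ω₀ → 𝕂), Measurable X ∧ HasFullSupport X P₀ ∧
        ∀ (Ω : Type*) [MeasurableSpace Ω] (P : Measure Ω) [IsProbabilityMeasure P]
          (Y : ℕ → Ω → 𝕂), IsIIDCopies Y P X P₀ →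
          IsExactFHCSeries T (fun n => (shiftBeta w n)⁻¹ • e n) Y P) ∧
    (Summable (fun n : ℕ =>
        ((√(Real.log ((n + 1 : ℕ) : ℝ)) : ℝ) : 𝕂) • (shiftBeta w (n + 1))⁻¹ • e (n + 1)) →
      (∀ (Ω₀ : Type*) [MeasurableSpace Ω₀] (P₀ : Measure Ω₀) [IsProbabilityMeasure P₀]
        (X : Ω₀ → 𝕂), Measurable X → IsSubgaussian X P₀ → HasFullSupport X P₀ →
        ∀ (Ω : Type*) [MeasurableSpace Ω] (P : Measure Ω) [IsProbabilityMeasure P]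
          (Y : ℕ → Ω → 𝕂), IsIIDCopies Y P X P₀ →
          IsExactFHCSeries T (fun n => (shiftBeta w n)⁻¹ • e n) Y P) ∧
      (∀ (Ω₀ : Type*) [MeasurableSpace Ω₀] (P₀ : Measure Ω₀) [IsProbabilityMeasure P₀]
        (X : Ω₀ → 𝕂), Measurable X → IsNonconstantGaussian X P₀ →
        ∀ (Ω : Type*) [MeasurableSpace Ω] (P : Measure Ω) [IsProbabilityMeasure P]
          (Y : ℕ → Ω → 𝕂), IsIIDCopies Y P X P₀ →
          IsExactFHCSeries T (fun n => (shiftBeta w n)⁻¹ • e n) Y P)) := by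
  have hB : HasContractingBasis 𝕂 E := by
    rcases hE with h | h
    · exact h.hasContractingBasis
    · exact LocallyConvexSpace.hasContractingBasis
  have hspan := hT.dense_span hdense
  refine ⟨fun hu => ?_, fun hu => ?_⟩
  · obtain ⟨α, hα, hαu⟩ := hu.exists_tendsto_atTop_smul (𝕂 := 𝕂)
    obtain ⟨Ω₀, mΩ₀, P₀, hP₀, X, hX, hfull, htail⟩ := exists_hasFullSupport_tsum_ne_top 𝕂 hα
    refine ⟨Ω₀, mΩ₀, P₀, hP₀, X, hX, hfull, fun Ω _ P _ Y hY => ?_⟩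
    have := Measure.isProbabilityMeasure_map (μ := P₀) hX.aemeasurable
    have := hfull.isOpenPosMeasure_map hX.aemeasurable
    exact isExactFHCSeries_of_tsum_ne_top hB hT.map_inv_shiftBeta_smul_zero
        hT.map_inv_shiftBeta_smul_succ hspan hαu htail
      hY.aemeasurable_and_map_eq.1 hY.aemeasurable_and_map_eq.2
  · have hαu : ∀ M : ℝ, Summable fun n : ℕ =>
        ((M * √(Real.log n) : ℝ) : 𝕂) • (shiftBeta w n)⁻¹ • e n := by
      intro M
      rw [← summable_nat_add_iff 1]
      refine (hu.const_smul (M : 𝕂)).congr fun n => ?_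
      rw [RCLike.ofReal_mul, ← smul_smul]
    refine ⟨fun Ω₀ _ P₀ _ X hX hsub hfull Ω _ P _ Y hY => ?_,
      fun Ω₀ _ P₀ _ X hX hG Ω _ P _ Y hY => ?_⟩
    · have := Measure.isProbabilityMeasure_map (μ := P₀) hX.aemeasurable
      have := hfull.isOpenPosMeasure_map hX.aemeasurable
      obtain ⟨c, hc, h⟩ := hsub
      obtain ⟨M, hM⟩ := exists_tsum_measure_lt_norm_ne_top (ν := P₀.map X) hc fun t ht => by
        rw [map_measureReal_apply hX (measurableSet_le measurable_const measurable_norm)]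
        exact h t ht
      exact isExactFHCSeries_of_tsum_ne_top hB hT.map_inv_shiftBeta_smul_zero
        hT.map_inv_shiftBeta_smul_succ hspan (hαu M) hM
        hY.aemeasurable_and_map_eq.1 hY.aemeasurable_and_map_eq.2
    · have := hG.gaussian.isGaussian_map
      have := hG.isOpenPosMeasure_map
      obtain ⟨c, hc, K, h⟩ := IsGaussian.exists_measure_norm_le (ν := P₀.map X)
      obtain ⟨M, hM⟩ := exists_tsum_measure_lt_norm_ne_top hc h
      exact isExactFHCSeries_of_tsum_ne_top hB hT.map_inv_shiftBeta_smul_zero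
        hT.map_inv_shiftBeta_smul_succ hspan (hαu M) hM
        hY.aemeasurable_and_map_eq.1 hY.aemeasurable_and_map_eq.2
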